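/- Let \(n\) be a dimension and \(\mathbb R^{n+1}_+:=\mathbb R^n\times(0,\infty)\). For \(x\in\mathbb R^n\) and \(h>0\) put \(\Gamma(x):=\{(y,t)\in\mathbb R^{n+1}_+:|y-x|<t\}\) and \(\Gamma^h(x):=\{(y,t)\in\Gamma(x):t<h\}\). Let \(H:=L^2(\mathbb R^{n+1}_+,t^{-n-1}\,dy\,dt)\) (complex-valued functions). Let \((\gamma_j)_{j\ge1}\) be independent complex standard Gaussian random variables (normalized by \(\mathbb E|\gamma_j|^2=1\)) on a probability space \(\Omega\). For a complex Banach space \(Y\), the space \(\gamma(H,Y)\) consists of the bounded linear \(T:H\to Y\) for which, for some (equivalently, every) orthonormal basis \((e_j)_{j\ge1}\) of \(H\), the series \(\sum_{j}\gamma_jTe_j\) converges in \(L^2(\Omega;Y)\), and \(\|T\|_{\gamma(H,Y)}:=\big\|\sum_{j}\gamma_jTe_j\big\|_{L^2(\Omega;Y)}\). For \(f:\mathbb R^{n+1}_+\to Y\), let \(\|f\|_{\gamma(Y)}:=\|I_f\|_{\gamma(H,Y)}\) if \(\langle f(\cdot),y'\rangle\in H\) for all \(y'\in Y'\) and the operator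 \(I_f:H\to Y\) determined by \(\langle I_fh,y'\rangle=\iint\langle f(y,t),y'\rangle h(y,t)\,\frac{dy\,dt}{t^{n+1}}\) (for all \(h\in H\), \(y'\in Y'\)) belongs to \(\gamma(H,Y)\); otherwise \(\|f\|_{\gamma(Y)}:=\infty\). For \(F:\mathbb R^{n+1}_+\to Y\), \(x\in\mathbb R^n\), \(h>0\) and \(q\in(0,\infty)\) define, with values in \([0,\infty]\), \[A(F)(x):=\|F\cdot1_{\Gamma(x)}\|_{\gamma(Y)},\qquad A(F|h)(x):=\|F\cdot1_{\Gamma^h(x)}\|_{\gamma(Y)},\] \[C_q(F)(x):=\sup_{B\ni x}\Big(\frac1{|B|}\int_BA(F|r(B))(y)^q\,dy\Big)^{1/q},\] where the supremum is over all open balls \(B\subset\mathbb R^n\) containing \(x\), and \(r(B)\) is the radius of \(B\). Theorem. For every \(n\) and every \(q\in(0,\infty)\) there is a finite constant \(K\), depending only on \(n\) and \(q\), such that for every complex Banach space \(X\) with dual \(X'\) and all strongly measurable functions \(F:\mathbb R^{n+1}_+\to X\) and \(G:\mathbb R^{n+1}_+\to X'\), \[\iint_{\mathbb R^{n+1}_+}|\langle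 F(y,t),G(y,t)\rangle|\,\frac{dy\,dt}{t}\le K\int_{\mathbb R^n}C_q(F)(x)\,A(G)(x)\,dx,\] where both sides are integrals with values in \([0,\infty]\) and \(0\cdot\infty=0\). -/

import Mathlib

open MeasureTheory ProbabilityTheory Set Filter
open scoped ENNReal NNReal Topology

noncomputable section

/-- The law of a complex standard Gaussian variable: real and imaginary parts are independent
centred real Gaussians of variance `1/2`, so that the second absolute moment is `1`. -/
def complexStdGaussian : Measure ℂ :=
  ((gaussianReal 0 (1 / 2)).prod (gaussianReal 0 (1 / 2))).map Complex.measurableEquivRealProd.symm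

instance instIsProbabilityMeasureComplexStdGaussian : IsProbabilityMeasure complexStdGaussian :=
  Measure.isProbabilityMeasure_map Complex.measurableEquivRealProd.symm.measurable.aemeasurable

/-- The probability space `ℂ^ℕ` with the product measure, on which the coordinate functions
`ω ↦ ω j` are a sequence of independent complex standard Gaussian variables. -/
def gaussProb : Measure (ℕ → ℂ) :=
  Measure.infinitePi fun _ => complexStdGaussian

section GaussSpace

variable {H : Type*} [NormedAddCommGroup H] [InnerProductSpace ℂ H]
  {X : Type*} [NormedAddCommGroup X] [NormedSpace ℂ X]

/-- `S` is the sum, convergent in `L²(Ω; X)`, of the series `∑ j, γ_j T e_j`, where `e` is an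
orthonormal basis of `H` and `γ_j` are the independent complex standard Gaussian variables. -/
def IsGaussSum (T : H →L[ℂ] X) (e : HilbertBasis ℕ ℂ H) (S : (ℕ → ℂ) → X) : Prop :=
  MemLp S 2 gaussProb ∧
    Tendsto (fun N : ℕ =>
      eLpNorm (fun ω => (∑ j ∈ Finset.range N, ω j • T (e j)) - S ω) 2 gaussProb) atTop (𝓝 0)

/-- The norm of `T` in the Gauss space `γ(H, X)`, for `H` separable and infinite-dimensional:
the `L²(Ω; X)` norm of `∑ j, γ_j T e_j` if this series converges in `L²(Ω; X)` for some orthonormal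
basis `e` of `H` (the value does not depend on the basis), and `∞` if `T` is not in `γ(H, X)`. -/
def gaussOpNorm (T : H →L[ℂ] X) : ℝ≥0∞ :=
  ⨅ (e : HilbertBasis ℕ ℂ H) (S : (ℕ → ℂ) → X) (_ : IsGaussSum T e S), eLpNorm S 2 gaussProb

end GaussSpace

section GaussFunction

variable {M : Type*} [MeasurableSpace M] {X : Type*} [NormedAddCommGroup X] [NormedSpace ℂ X]

/-- `f` is weakly `L²(μ)`, and `T` is the operator `I_f : L²(μ) → X` that sends `h` to the Pettis
integral of `f · h`, i.e. to the vector `v` with `⟨v, x'⟩ = ∫ ⟨f, x'⟩ h dμ` for all `x' ∈ X'`.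
There is at most one such `T`. -/
def IsPettisOperator (μ : Measure M) (f : M → X) (T : Lp ℂ 2 μ →L[ℂ] X) : Prop :=
  ∀ x' : StrongDual ℂ X,
    MemLp (fun s => x' (f s)) 2 μ ∧
      ∀ h : Lp ℂ 2 μ, x' (T h) = ∫ s, x' (f s) * h s ∂μ

/-- The Gauss norm of a function `f : M → X`: the norm of `I_f` in `γ(L²(μ), X)`, and `∞` if `f` is
not weakly `L²` or if `I_f` is not in `γ(L²(μ), X)`. -/
def gaussNorm (μ : Measure M) (f : M → X) : ℝ≥0∞ :=
  ⨅ (T : Lp ℂ 2 μ →L[ℂ] X) (_ : IsPettisOperator μ f T), gaussOpNorm T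

end GaussFunction

section Functionals

variable {n : ℕ} {X : Type*} [NormedAddCommGroup X] [NormedSpace ℂ X]

/-- The upper half-space, as the subset `t > 0` of the pairs `(y, t) ∈ ℝⁿ × ℝ`. Functions on it are
represented by functions on all pairs, of which only the values at `t > 0` are ever used. -/
def upperHalfSpace (n : ℕ) : Set (EuclideanSpace ℝ (Fin n) × ℝ) :=
  {p | 0 < p.2}

/-- The measure `dy dt / t^(n+1)` on the upper half-space. -/
def coneMeasure (n : ℕ) : Measure (EuclideanSpace ℝ (Fin n) × ℝ) :=
  (volume.restrict (upperHalfSpace n)).withDensity fun p => (ENNReal.ofReal (p.2 ^ (n + 1)))⁻¹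

/-- The cone with vertex `x` and aperture one. -/
def cone (x : EuclideanSpace ℝ (Fin n)) : Set (EuclideanSpace ℝ (Fin n) × ℝ) :=
  {p | 0 < p.2 ∧ ‖p.1 - x‖ < p.2}

/-- The cone with vertex `x` and aperture one, truncated at height `h`. -/
def truncCone (x : EuclideanSpace ℝ (Fin n)) (h : ℝ) : Set (EuclideanSpace ℝ (Fin n) × ℝ) :=
  {p | p ∈ cone x ∧ p.2 < h}

/-- The conical square function `A(F)(x)`. -/
def functionalA (F : EuclideanSpace ℝ (Fin n) × ℝ → X) (x : EuclideanSpace ℝ (Fin n)) : ℝ≥0∞ :=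
  gaussNorm (coneMeasure n) ((cone x).indicator F)

/-- The truncated conical square function `A(F|h)(x)`. -/
def functionalATrunc (F : EuclideanSpace ℝ (Fin n) × ℝ → X) (h : ℝ)
    (x : EuclideanSpace ℝ (Fin n)) : ℝ≥0∞ :=
  gaussNorm (coneMeasure n) ((truncCone x h).indicator F)

/-- The functional `C_q(F)(x)`: the supremum, over all open balls `B = B(c, r)` that contain `x`, of
the `L^q` averages over `B` of `A(F|r)`. -/
def functionalC (q : ℝ) (F : EuclideanSpace ℝ (Fin n) × ℝ → X)
    (x : EuclideanSpace ℝ (Fin n)) : ℝ≥0∞ :=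
  ⨆ (c : EuclideanSpace ℝ (Fin n)) (r : ℝ) (_ : x ∈ Metric.ball c r),
    ((volume (Metric.ball c r))⁻¹ *
      ∫⁻ y in Metric.ball c r, functionalATrunc F r y ^ q) ^ (1 / q)

end Functionals

end

/-! The proof is an averaging argument with a stopping height. The ball `B(y,t)` competes in the
supremum defining `C_q(F)(x)` for each of its points `x`, so by Chebyshev at least half of these `x`
satisfy `A(F|t)(x) ≤ 2^(1/q) C_q(F)(x)` (`volume_ball_le_two_mul`). Hence `t^n |⟨F,G⟩|` is at most
`2/|B(0,1)|` times its integral over the good `x`, and Tonelli leaves, for each `x`, the integral of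
`|⟨F,G⟩|` over the points of the cone at good height. As `A(F|t)(x)` increases with `t`, these
points fill, up to a null set, a union of truncated cones on which the Gauss norm of `F` is at most
`2^(1/q) C_q(F)(x)` (`setLIntegral_stopped_cone_le`). The duality `∫ |⟨f,g⟩| ≤ ‖f‖_γ ‖g‖_γ` on each
of them gives `K = 2 · 2^(1/q) / |B(0,1)|`.

Duality for finite Gaussian sums is orthogonality plus Cauchy-Schwarz; functions reduce to it by
averaging over pieces where `f` hardly oscillates (`setLIntegral_apply_le`).

Chebyshev and Tonelli need joint measurability in `(x,t)`. The Gauss norm is therefore replaced by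
`gaussSup`, which only tests finite families: it lies below `gaussNorm`, still carries the duality,
and is lower semicontinuous in the cone. A minorant suffices because both functionals stand on the
right-hand side. -/

noncomputable section

/-! ### Complex Gaussian vectors: characteristic functions and invariance. -/

section GaussVector

variable {ι κ : Type*} [Fintype ι] [Fintype κ]

/-- The law of a vector of independent complex standard Gaussian variables. -/
def gaussVec (ι : Type*) [Fintype ι] : Measure (EuclideanSpace ℂ ι) :=
  (Measure.pi fun _ : ι => complexStdGaussian).map (WithLp.toLp 2)

instance isProbabilityMeasure_gaussVec : IsProbabilityMeasure (gaussVec ι) :=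
  Measure.isProbabilityMeasure_map (by fun_prop)

lemma charFun_complexStdGaussian (t : ℂ) :
    charFun complexStdGaussian t = Complex.exp (-(‖t‖ ^ 2 : ℝ) / 4) := by
  rw [charFun_apply, complexStdGaussian, integral_map_equiv]
  have h (p : ℝ × ℝ) : Complex.exp ((inner ℝ (Complex.measurableEquivRealProd.symm p) t : ℝ) *
      Complex.I) = Complex.exp (t.re * p.1 * Complex.I) * Complex.exp (t.im * p.2 * Complex.I) := by
    rw [← Complex.exp_add]
    congr 1
    simp [Complex.inner, Complex.measurableEquivRealProd]
    ring
  simp_rw [h]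
  rw [integral_prod_mul (fun a : ℝ => Complex.exp (t.re * a * Complex.I))
    (fun a : ℝ => Complex.exp (t.im * a * Complex.I)), ← charFun_apply_real,
    ← charFun_apply_real, charFun_gaussianReal, charFun_gaussianReal, ← Complex.exp_add,
    ← Complex.normSq_eq_norm_sq, Complex.normSq_apply]
  congr 1
  push_cast
  simp
  ring

lemma charFun_gaussVec (t : EuclideanSpace ℂ ι) :
    charFun (gaussVec ι) t = Complex.exp (-(‖t‖ ^ 2 : ℝ) / 4) := by
  rw [gaussVec, charFun_pi]
  simp_rw [charFun_complexStdGaussian]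
  rw [← Complex.exp_sum, EuclideanSpace.norm_sq_eq]
  congr 1
  push_cast
  rw [← Finset.sum_neg_distrib, Finset.sum_div]

/-- The characteristic function depends on the norm alone. Real-linear isometries are admitted so
that coordinatewise conjugation is covered. -/
lemma measurePreserving_gaussVec (U : EuclideanSpace ℂ ι ≃ₗᵢ[ℝ] EuclideanSpace ℂ ι) :
    MeasurePreserving U (gaussVec ι) (gaussVec ι) := by
  refine ⟨U.continuous.measurable, ?_⟩
  have := Measure.isProbabilityMeasure_map (μ := gaussVec ι) U.continuous.measurable.aemeasurable
  refine Measure.ext_of_charFun (funext fun t => ?_)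
  have h := charFun_gaussVec (U.symm t)
  rw [charFun_apply] at h
  rw [charFun_apply, integral_map (by fun_prop) (by fun_prop), charFun_gaussVec]
  rw [U.symm.norm_map] at h
  rw [← h]
  congr 1 with x
  rw [← U.inner_map_map x (U.symm t), U.apply_symm_apply]

lemma real_inner_eq_re_inner_euclidean (x y : EuclideanSpace ℂ ι) :
    inner ℝ x y = (inner ℂ x y).re := by
  simp [PiLp.inner_apply, Complex.inner]

-- Since `1 - A*A` is positive, it factors as `D*D`. This `D` supplies the variance that a
-- contraction loses.
open ContinuousLinearMap in
lemma exists_norm_sq_add_norm_sq_eq {E F : Type*} [NormedAddCommGroup E] [InnerProductSpace ℂ E]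
    [CompleteSpace E] [NormedAddCommGroup F] [InnerProductSpace ℂ F] [CompleteSpace F]
    (A : E →L[ℂ] F) (hA : ‖A‖ ≤ 1) :
    ∃ D : E →L[ℂ] E, ∀ t, ‖A t‖ ^ 2 + ‖D t‖ ^ 2 = ‖t‖ ^ 2 := by
  have hpos : (0 : E →L[ℂ] E) ≤ 1 - adjoint A ∘L A := by
    rw [ContinuousLinearMap.nonneg_iff_isPositive, ContinuousLinearMap.isPositive_iff_complex]
    intro x
    have h : inner ℂ ((1 - adjoint A ∘L A) x) x = ((‖x‖ ^ 2 - ‖A x‖ ^ 2 : ℝ) : ℂ) := by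
      push_cast
      simp [adjoint_inner_left, inner_self_eq_norm_sq_to_K]
    rw [h]
    refine ⟨congrArg _ (Complex.ofReal_re _), ?_⟩
    have : ‖A x‖ ≤ ‖x‖ := by simpa using A.le_of_opNorm_le hA x
    simp only [RCLike.re_to_complex, Complex.ofReal_re]
    have := norm_nonneg (A x)
    nlinarith
  obtain ⟨D, hD⟩ := CStarAlgebra.nonneg_iff_eq_star_mul_self.1 hpos
  rw [star_eq_adjoint, mul_def] at hD
  refine ⟨D, fun t => ?_⟩
  have h := congrArg (fun B : E →L[ℂ] E => RCLike.re (inner ℂ (B t) t)) hD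
  simp only [sub_apply, one_apply_eq_self, comp_apply, inner_sub_left, 
    adjoint_inner_left, map_sub,
    inner_self_eq_norm_sq] at h
  linarith

/-- The hypothesis says `LL* + DD* = 1`, so the covariances of the independent vectors `Lγ` and
`Dγ'` add up to that of a standard one. -/
lemma map_gaussVec_prod (L : EuclideanSpace ℂ ι →L[ℂ] EuclideanSpace ℂ κ)
    (D : EuclideanSpace ℂ κ →L[ℂ] EuclideanSpace ℂ κ)
    (h : ∀ t, ‖L.adjoint t‖ ^ 2 + ‖D.adjoint t‖ ^ 2 = ‖t‖ ^ 2) :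
    MeasurePreserving (fun p : EuclideanSpace ℂ ι × EuclideanSpace ℂ κ => L p.1 + D p.2)
      ((gaussVec ι).prod (gaussVec κ)) (gaussVec κ) := by
  have hm : Measurable (fun p : EuclideanSpace ℂ ι × EuclideanSpace ℂ κ => L p.1 + D p.2) := by
    fun_prop
  refine ⟨hm, ?_⟩
  have := Measure.isProbabilityMeasure_map (μ := (gaussVec ι).prod (gaussVec κ)) hm.aemeasurable
  refine Measure.ext_of_charFun (funext fun t => ?_)
  rw [charFun_apply, integral_map (by fun_prop) (by fun_prop), charFun_gaussVec]
  have h1 (p : EuclideanSpace ℂ ι × EuclideanSpace ℂ κ) :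
      Complex.exp ((inner ℝ (L p.1 + D p.2) t : ℝ) * Complex.I) =
      Complex.exp ((inner ℝ p.1 (L.adjoint t) : ℝ) * Complex.I) *
        Complex.exp ((inner ℝ p.2 (D.adjoint t) : ℝ) * Complex.I) := by
    simp only [real_inner_eq_re_inner_euclidean, inner_add_left,
      ContinuousLinearMap.adjoint_inner_right]
    rw [← Complex.exp_add]
    push_cast
    ring_nf
  simp_rw [h1]
  rw [integral_prod_mul (fun a => Complex.exp ((inner ℝ a (L.adjoint t) : ℝ) * Complex.I))
    (fun a => Complex.exp ((inner ℝ a (D.adjoint t) : ℝ) * Complex.I)), ← charFun_apply,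
    ← charFun_apply, charFun_gaussVec, charFun_gaussVec, ← Complex.exp_add, ← h t]
  congr 1
  push_cast
  ring

end GaussVector

/-! ### Finite Gaussian sums: contraction, orthogonality and duality. -/

section GaussSum

variable {ι κ : Type*} [Fintype ι] [Fintype κ] {X : Type*} [NormedAddCommGroup X] [NormedSpace ℂ X]

/-- The `L²` norm of the Gaussian sum `∑ k, γ_k x_k`. -/
def gaussSumNorm (x : ι → X) : ℝ≥0∞ :=
  eLpNorm (fun ω : EuclideanSpace ℂ ι => ∑ k, ω k • x k) 2 (gaussVec ι)

lemma continuous_gaussian_sum (x : ι → X) :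
    Continuous fun ω : EuclideanSpace ℂ ι => ∑ k, ω k • x k := by
  fun_prop

/-- Comparison of Gaussian sums: a contraction of the coefficients decreases the `L²` norm. -/
lemma eLpNorm_contraction_le_gaussSumNorm (L : EuclideanSpace ℂ ι →L[ℂ] EuclideanSpace ℂ κ)
    (hL : ‖L‖ ≤ 1) (x : κ → X) :
    eLpNorm (fun ω => ∑ k, L ω k • x k) 2 (gaussVec ι) ≤ gaussSumNorm x := by
  obtain ⟨D, hD⟩ := exists_norm_sq_add_norm_sq_eq L.adjoint (by simpa using hL)
  set Φ : EuclideanSpace ℂ κ → X := fun ω => ∑ k, ω k • x k with hΦ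
  have hc : Continuous Φ := continuous_gaussian_sum x
  have hp := map_gaussVec_prod L D.adjoint (by simpa using hD)
  have hm := map_gaussVec_prod L (-D.adjoint) (by simpa using hD)
  have h1 := eLpNorm_comp_measurePreserving (p := 2) hc.aestronglyMeasurable hp
  have h2 := eLpNorm_comp_measurePreserving (p := 2) hc.aestronglyMeasurable hm
  have h3 := eLpNorm_comp_measurePreserving (p := 2) (g := fun ω => Φ (L ω))
    (hc.comp L.continuous).aestronglyMeasurable
    (measurePreserving_fst (μ := gaussVec ι) (ν := gaussVec κ))
  -- `Lγ` is the mean of `Lγ + D*γ'` and `Lγ - D*γ'`, both standard Gaussian; the triangle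
  -- inequality then gives the bound.
  have h4 : (fun ω => Φ (L ω)) ∘ Prod.fst =
      (2⁻¹ : ℂ) • ((Φ ∘ fun p : EuclideanSpace ℂ ι × EuclideanSpace ℂ κ => L p.1 + D.adjoint p.2) +
        (Φ ∘ fun p => L p.1 + (-D.adjoint) p.2)) := by
    funext p
    simp only [hΦ, Function.comp_apply, Pi.smul_apply, Pi.add_apply, ← Finset.sum_add_distrib,
      Finset.smul_sum, ← add_smul, smul_smul, PiLp.add_apply, neg_apply,
      PiLp.neg_apply]
    refine Finset.sum_congr rfl fun k _ => ?_
    congr 1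
    ring
  change eLpNorm (fun ω => Φ (L ω)) 2 (gaussVec ι) ≤ eLpNorm Φ 2 (gaussVec κ)
  rw [← h3, h4, eLpNorm_const_smul]
  refine (mul_le_mul_right (eLpNorm_add_le (by fun_prop) (by fun_prop) (by norm_num)) _).trans ?_
  rw [h1, h2, ← two_mul, ← mul_assoc]
  have : ‖(2⁻¹ : ℂ)‖ₑ * 2 = 1 := by
    rw [enorm_inv (by norm_num), show ‖(2 : ℂ)‖ₑ = 2 by simp [← ofReal_norm]]
    exact ENNReal.inv_mul_cancel (by norm_num) (by norm_num)
  rw [this, one_mul]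

lemma measurePreserving_gaussVec_eval (k : ι) :
    MeasurePreserving (fun ω : EuclideanSpace ℂ ι => ω k) (gaussVec ι) complexStdGaussian := by
  have h : MeasurePreserving (WithLp.toLp 2) (Measure.pi fun _ : ι => complexStdGaussian)
    (gaussVec ι) := ⟨by fun_prop, rfl⟩
  refine ⟨by fun_prop, ?_⟩
  rw [gaussVec, Measure.map_map (by fun_prop) (by fun_prop)]
  exact (measurePreserving_eval (fun _ : ι => complexStdGaussian) k).map_eq

lemma memLp_id_complexStdGaussian : MemLp (fun z : ℂ => z) 2 complexStdGaussian := by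
  have hr : MemLp (fun x : ℝ => x) 2 (gaussianReal 0 (1 / 2)) := memLp_id_gaussianReal 2
  rw [complexStdGaussian, MeasurableEquiv.memLp_map_measure_iff]
  refine ((hr.comp_fst _).norm.add (hr.comp_snd _).norm).mono (by fun_prop)
    (ae_of_all _ fun p => (Complex.norm_le_abs_re_add_abs_im _).trans ?_)
  exact le_abs_self (|p.1| + |p.2|)

lemma integral_norm_sq_complexStdGaussian : ∫ z, ‖z‖ ^ 2 ∂complexStdGaussian = 1 := by
  have hr : MemLp (fun x : ℝ => x) 2 (gaussianReal 0 (1 / 2)) := memLp_id_gaussianReal 2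
  have hv : ∫ x, x ^ 2 ∂gaussianReal 0 (1 / 2) = 1 / 2 := by
    have := variance_fun_id_gaussianReal (μ := 0) (v := 1 / 2)
    rw [variance_eq_integral (by fun_prop)] at this
    simpa using this
  rw [complexStdGaussian, integral_map_equiv]
  have (p : ℝ × ℝ) : ‖Complex.measurableEquivRealProd.symm p‖ ^ 2 = p.1 ^ 2 + p.2 ^ 2 := by
    rw [← Complex.normSq_eq_norm_sq, Complex.normSq_apply]
    simp [Complex.measurableEquivRealProd]
    ring
  simp_rw [this]
  rw [integral_add (hr.comp_fst _).integrable_sq (hr.comp_snd _).integrable_sq,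
    integral_fun_fst (fun x : ℝ => x ^ 2), integral_fun_snd (fun x : ℝ => x ^ 2), hv]
  norm_num

lemma memLp_gaussVec_eval (k : ι) :
    MemLp (fun ω : EuclideanSpace ℂ ι => ω k) 2 (gaussVec ι) :=
  memLp_id_complexStdGaussian.comp_measurePreserving (measurePreserving_gaussVec_eval k)

lemma integrable_gaussVec_mul (j k : ι) :
    Integrable (fun ω : EuclideanSpace ℂ ι => starRingEnd ℂ (ω j) * ω k) (gaussVec ι) :=
  (memLp_gaussVec_eval j).star.integrable_mul (memLp_gaussVec_eval k)

lemma integral_gaussVec_mul [DecidableEq ι] (j k : ι) :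
    ∫ ω : EuclideanSpace ℂ ι, starRingEnd ℂ (ω j) * ω k ∂gaussVec ι = if j = k then 1 else 0 := by
  split_ifs with hjk
  · subst hjk
    have h := integral_norm_sq_complexStdGaussian
    rw [← (measurePreserving_gaussVec_eval j).map_eq, integral_map (by fun_prop) (by fun_prop)] at h
    simp_rw [Complex.conj_mul', ← Complex.ofReal_pow]
    rw [integral_complex_ofReal, h, Complex.ofReal_one]
  -- Flipping the sign of the coordinate `j` preserves the law and negates the integrand.
  · let U : EuclideanSpace ℂ ι ≃ₗᵢ[ℝ] EuclideanSpace ℂ ι := LinearIsometryEquiv.piLpCongrRight 2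
      fun i => if i = j then LinearIsometryEquiv.neg ℝ else LinearIsometryEquiv.refl ℝ ℂ
    have h := (measurePreserving_gaussVec U).integral_comp
      U.toHomeomorph.measurableEmbedding
      (fun ω : EuclideanSpace ℂ ι => starRingEnd ℂ (ω j) * ω k)
    have hU (ω : EuclideanSpace ℂ ι) :
        starRingEnd ℂ (U ω j) * U ω k = -(starRingEnd ℂ (ω j) * ω k) := by
      simp [U, Ne.symm hjk]
    simp_rw [hU, integral_neg] at h
    exact self_eq_neg.1 h.symm

lemma eLpNorm_gaussVec_smul (k : ι) (z : X) :
    eLpNorm (fun ω : EuclideanSpace ℂ ι => ω k • z) 2 (gaussVec ι) = ‖z‖ₑ := by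
  classical
  have h : ∫⁻ ω : EuclideanSpace ℂ ι, ‖ω k‖ₑ ^ 2 ∂gaussVec ι = 1 := by
    have h1 := integral_norm_sq_complexStdGaussian
    rw [integral_eq_lintegral_of_nonneg_ae (ae_of_all _ fun _ => by positivity) (by fun_prop)] at h1
    have h2 := (ENNReal.toReal_eq_one_iff _).1 h1
    rw [← (measurePreserving_gaussVec_eval k).map_eq, lintegral_map (by fun_prop) (by fun_prop)]
      at h2
    rw [← h2]
    simp_rw [ENNReal.ofReal_pow (norm_nonneg _), ofReal_norm]
  rw [eLpNorm_eq_lintegral_rpow_enorm_toReal (by norm_num) (by norm_num)]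
  simp_rw [enorm_smul, ENNReal.toReal_ofNat, ENNReal.rpow_ofNat, mul_pow]
  rw [lintegral_mul_const _ (by fun_prop), h, one_mul, ← ENNReal.rpow_ofNat, ← ENNReal.rpow_mul]
  norm_num

lemma gaussSumNorm_le_add (x y : ι → X) : gaussSumNorm x ≤ gaussSumNorm y + ∑ k, ‖x k - y k‖ₑ := by
  have h : (fun ω : EuclideanSpace ℂ ι => ∑ k, ω k • x k) =
      (fun ω => ∑ k, ω k • y k) + ∑ k, fun ω => ω k • (x k - y k) := by
    funext ω
    simp [← Finset.sum_add_distrib, ← smul_add]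
  rw [gaussSumNorm, h]
  refine (eLpNorm_add_le (by fun_prop) (by fun_prop) (by norm_num)).trans ?_
  refine add_le_add le_rfl ((eLpNorm_sum_le (fun k _ => by fun_prop) (by norm_num)).trans_eq ?_)
  simp_rw [eLpNorm_gaussVec_smul]

lemma lowerSemicontinuous_gaussSumNorm : LowerSemicontinuous (gaussSumNorm : (ι → X) → ℝ≥0∞) := by
  intro x b hb
  have h : Tendsto (fun y : ι → X => b + ∑ k, ‖x k - y k‖ₑ) (𝓝 x) (𝓝 b) := by
    have : Continuous fun y : ι → X => b + ∑ k, ‖x k - y k‖ₑ := by fun_prop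
    simpa using this.tendsto x
  filter_upwards [h.eventually_lt_const hb] with y hy
  have hs : ∑ k, ‖x k - y k‖ₑ ≠ ⊤ := by simp [ENNReal.sum_eq_top]
  exact lt_of_add_lt_add_right (hy.trans_le (gaussSumNorm_le_add x y))

/-- Duality pairs `γ_k` with its conjugate, because `E γ_k² = 0` for complex Gaussians; this lemma
makes the conjugate harmless. -/
lemma eLpNorm_gaussVec_conj (x : ι → X) :
    eLpNorm (fun ω : EuclideanSpace ℂ ι => ∑ k, starRingEnd ℂ (ω k) • x k) 2 (gaussVec ι) =
      gaussSumNorm x := by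
  let U : EuclideanSpace ℂ ι ≃ₗᵢ[ℝ] EuclideanSpace ℂ ι :=
    LinearIsometryEquiv.piLpCongrRight 2 fun _ => Complex.conjLIE
  have h : (fun ω : EuclideanSpace ℂ ι => ∑ k, starRingEnd ℂ (ω k) • x k) =
      (fun ω : EuclideanSpace ℂ ι => ∑ k, ω k • x k) ∘ U := by
    funext ω
    simp [U]
  rw [h, eLpNorm_comp_measurePreserving (continuous_gaussian_sum x).aestronglyMeasurable
    (measurePreserving_gaussVec U), gaussSumNorm]

/-- Duality for Gaussian sums. -/
lemma enorm_sum_apply_le_gaussSumNorm_mul (f : ι → X) (g : ι → StrongDual ℂ X) :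
    ‖∑ k, g k (f k)‖ₑ ≤ gaussSumNorm f * gaussSumNorm g := by
  classical
  set A : EuclideanSpace ℂ ι → StrongDual ℂ X := fun ω => ∑ j, starRingEnd ℂ (ω j) • g j with hA
  set B : EuclideanSpace ℂ ι → X := fun ω => ∑ k, ω k • f k with hB
  have hAc : Continuous A := by fun_prop
  have hBc : Continuous B := by fun_prop
  -- Orthonormality of the `γ_k` kills the off-diagonal terms of the double sum.
  have h : ∑ k, g k (f k) = ∫ ω, A ω (B ω) ∂gaussVec ι := by
    have h1 (ω : EuclideanSpace ℂ ι) :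
        A ω (B ω) = ∑ j, ∑ k, starRingEnd ℂ (ω j) * ω k * g j (f k) := by
      simp only [hA, hB, sum_apply, map_sum, smul_apply,
        map_smul, smul_eq_mul, Finset.mul_sum]
      rw [Finset.sum_comm]
      exact Finset.sum_congr rfl fun j _ => Finset.sum_congr rfl fun k _ => by ring
    simp_rw [h1]
    rw [integral_finsetSum _ fun j _ => integrable_finsetSum _ fun k _ =>
      (integrable_gaussVec_mul j k).mul_const _]
    simp_rw [integral_finsetSum _ fun k _ => (integrable_gaussVec_mul _ k).mul_const _,
      integral_mul_const, integral_gaussVec_mul]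
    simp
  have hconj : eLpNorm A 2 (gaussVec ι) = gaussSumNorm g := eLpNorm_gaussVec_conj g
  rw [h]
  refine (enorm_integral_le_lintegral_enorm _).trans ?_
  refine (lintegral_mono fun ω => (A ω).le_opENorm (B ω)).trans ?_
  refine (ENNReal.lintegral_mul_le_Lp_mul_Lq _ Real.HolderConjugate.two_two
    (by fun_prop) (by fun_prop)).trans_eq ?_
  rw [mul_comm, ← hconj, gaussSumNorm, eLpNorm_eq_lintegral_rpow_enorm_toReal (by norm_num) (by norm_num),
    eLpNorm_eq_lintegral_rpow_enorm_toReal (by norm_num) (by norm_num)]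
  simp [hB]

end GaussSum

/-! ### Finite Gaussian sums below the operator Gauss norm. -/

section GaussOp

variable {ι : Type*} [Fintype ι] {H : Type*} [NormedAddCommGroup H] [InnerProductSpace ℂ H]
  {X : Type*} [NormedAddCommGroup X] [NormedSpace ℂ X]

lemma eLpNorm_gaussProb_sum (I : Finset ℕ) (x : ℕ → X) :
    eLpNorm (fun ω : ℕ → ℂ => ∑ j ∈ I, ω j • x j) 2 gaussProb =
      gaussSumNorm fun j : I => x j := by
  have hmp : MeasurePreserving (fun ω : ℕ → ℂ => WithLp.toLp 2 (I.restrict ω)) gaussProb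
      (gaussVec I) := by
    refine ⟨by fun_prop, ?_⟩
    have := Measure.infinitePi_map_restrict (fun _ : ℕ => complexStdGaussian) (I := I)
    rw [gaussVec, ← this, Measure.map_map (by fun_prop) (by fun_prop)]
    rfl
  rw [gaussSumNorm, ← eLpNorm_comp_measurePreserving
    (continuous_gaussian_sum (fun j : I => x j)).aestronglyMeasurable hmp]
  congr 1
  funext ω
  exact (Finset.sum_coe_sort I fun j => ω j • x j).symm

/-- Expanding the `h j` in `e` up to order `N` makes their Gaussian sum a contraction of the partial
sum of `γ_k T e_k`, by Bessel; then `N → ∞`. The basis is arbitrary, so its independence is never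
needed. -/
lemma gaussSumNorm_le_of_isGaussSum {T : H →L[ℂ] X} {e : HilbertBasis ℕ ℂ H} {S : (ℕ → ℂ) → X}
    (hS : IsGaussSum T e S) (h : ι → H) (hh : ∀ c : EuclideanSpace ℂ ι, ‖∑ j, c j • h j‖ ≤ ‖c‖) :
    gaussSumNorm (fun j => T (h j)) ≤ eLpNorm S 2 gaussProb := by
  let P : ℕ → H → H := fun N v => ∑ k ∈ Finset.range N, inner ℂ (e k) v • e k
  have hcontr (N : ℕ) : gaussSumNorm (fun j => T (P N (h j))) ≤
      gaussSumNorm fun k : Finset.range N => T (e k) := by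
    let L₀ : EuclideanSpace ℂ ι →ₗ[ℂ] EuclideanSpace ℂ (Finset.range N) :=
      { toFun := fun c => WithLp.toLp 2 fun k => inner ℂ (e k) (∑ j, c j • h j)
        map_add' := fun c d => by
          ext k
          simp [add_smul, Finset.sum_add_distrib]
        map_smul' := fun a c => by
          ext k
          simp [mul_smul, ← Finset.smul_sum] }
    let L := L₀.mkContinuous 1 fun c => by
      rw [one_mul]
      refine le_trans ?_ (hh c)
      refine le_of_sq_le_sq ?_ (norm_nonneg _)
      rw [EuclideanSpace.norm_sq_eq]
      have := e.orthonormal.sum_inner_products_le (x := ∑ j, c j • h j) (s := Finset.range N)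
      rw [← Finset.sum_coe_sort] at this
      exact this
    refine le_trans (le_of_eq ?_) (eLpNorm_contraction_le_gaussSumNorm L
      (LinearMap.mkContinuous_norm_le _ zero_le_one _) fun k : Finset.range N => T (e k))
    rw [gaussSumNorm]
    congr 1
    funext ω
    have hL (k : Finset.range N) : L ω k = ∑ j, ω j * inner ℂ (e k) (h j) := by
      simp [L, L₀]
    simp_rw [hL, P, map_sum, map_smul, Finset.sum_smul, Finset.smul_sum, smul_smul]
    rw [Finset.sum_comm, ← Finset.sum_coe_sort (Finset.range N)]
  have hbound (N : ℕ) : gaussSumNorm (fun j => T (h j)) ≤ eLpNorm S 2 gaussProb +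
      eLpNorm (fun ω => (∑ j ∈ Finset.range N, ω j • T (e j)) - S ω) 2 gaussProb +
        ∑ j, ‖T (h j) - T (P N (h j))‖ₑ := by
    refine (gaussSumNorm_le_add _ fun j => T (P N (h j))).trans (add_le_add ?_ le_rfl)
    refine (hcontr N).trans ?_
    have hc : AEStronglyMeasurable (fun ω : ℕ → ℂ => ∑ j ∈ Finset.range N, ω j • T (e j))
        gaussProb := Continuous.aestronglyMeasurable (by fun_prop)
    rw [← eLpNorm_gaussProb_sum (Finset.range N) fun k => T (e k)]
    refine le_trans (le_of_eq ?_) (eLpNorm_add_le hS.1.1 (hc.sub hS.1.1) (by norm_num))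
    congr 1
    funext ω
    simp
  have hlim : Tendsto (fun N => eLpNorm S 2 gaussProb +
      eLpNorm (fun ω => (∑ j ∈ Finset.range N, ω j • T (e j)) - S ω) 2 gaussProb +
        ∑ j, ‖T (h j) - T (P N (h j))‖ₑ) atTop
      (𝓝 (eLpNorm S 2 gaussProb + 0 + ∑ j : ι, ‖T (h j) - T (h j)‖ₑ)) := by
    refine (tendsto_const_nhds.add hS.2).add (tendsto_finsetSum _ fun j _ => ?_)
    have : Tendsto (fun N => P N (h j)) atTop (𝓝 (h j)) := by
      simpa only [e.repr_apply_apply] using (e.hasSum_repr (h j)).tendsto_sum_nat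
    exact (tendsto_const_nhds.sub ((T.continuous.tendsto _).comp this)).enorm
  simpa using ge_of_tendsto' hlim hbound

end GaussOp

/-! ### The minorant `gaussSup` of the Gauss norm. -/

section GaussSup

variable {M : Type*} [MeasurableSpace M] {μ : Measure M} {ι : Type*} [Fintype ι]
  {X : Type*} [NormedAddCommGroup X] [NormedSpace ℂ X]

/-- The functions `h j` are the images of the unit vectors under a contraction `ℂ^ι → L²(μ)`, and
the products `h j • f` are integrable. -/
structure IsTestFamily (μ : Measure M) (f : M → X) (h : ι → M → ℂ) : Prop where
  memLp : ∀ j, MemLp (h j) 2 μ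
  integrable : ∀ j, Integrable (fun s => h j s • f s) μ
  eLpNorm_le : ∀ c : EuclideanSpace ℂ ι, eLpNorm (fun s => ∑ j, c j * h j s) 2 μ ≤ ‖c‖ₑ

/-- The supremum of the Gaussian sums of the integrals over `E` of `f` against test families. It is
at most the Gauss norm of `f · 1_E`. -/
def gaussSup (μ : Measure M) (f : M → X) (E : Set M) : ℝ≥0∞ :=
  ⨆ (m : ℕ) (h : Fin m → M → ℂ) (_ : IsTestFamily μ f h),
    gaussSumNorm fun j => ∫ s in E, h j s • f s ∂μ

lemma IsTestFamily.gaussSumNorm_le {f : M → X} {m : ℕ} {h : Fin m → M → ℂ}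
    (hh : IsTestFamily μ f h) (E : Set M) :
    gaussSumNorm (fun j => ∫ s in E, h j s • f s ∂μ) ≤ gaussSup μ f E :=
  le_iSup_of_le m (le_iSup₂_of_le h hh le_rfl)

lemma gaussSup_le_gaussNorm [CompleteSpace X] (f : M → X) {E : Set M} (hE : MeasurableSet E) :
    gaussSup μ f E ≤ gaussNorm μ (E.indicator f) := by
  refine iSup_le fun m => iSup₂_le fun h hh => le_iInf₂ fun T hT => le_iInf fun e =>
    le_iInf₂ fun S hS => ?_
  -- Integrability of `h j • f` makes the Pettis integral a Bochner integral.
  have hTh (j : Fin m) : ∫ s in E, h j s • f s ∂μ = T ((hh.memLp j).toLp (h j)) := by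
    refine (SeparatingDual.eq_iff_forall_dual_eq (R := ℂ)).2 fun x' => ?_
    rw [(hT x').2, ← ContinuousLinearMap.integral_comp_comm _ (hh.integrable j).integrableOn,
      ← integral_indicator hE]
    refine integral_congr_ae ?_
    filter_upwards [(hh.memLp j).coeFn_toLp] with s hs
    rw [hs]
    by_cases h : s ∈ E <;> simp [h, mul_comm]
  simp_rw [hTh]
  refine gaussSumNorm_le_of_isGaussSum hS _ fun c => ?_
  rw [← enorm_le_iff_norm_le]
  refine le_trans (le_of_eq ?_) (hh.eLpNorm_le c)
  rw [Lp.enorm_def]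
  refine eLpNorm_congr_ae ?_
  have h1 : ∀ᵐ s ∂μ, ∀ j, (c j • (hh.memLp j).toLp (h j) : Lp ℂ 2 μ) s = c j * h j s := by
    rw [ae_all_iff]
    intro j
    filter_upwards [Lp.coeFn_smul (c j) ((hh.memLp j).toLp (h j)), (hh.memLp j).coeFn_toLp]
      with s h1 h2
    rw [h1, Pi.smul_apply, h2, smul_eq_mul]
  filter_upwards [h1, Lp.coeFn_finsetSum Finset.univ fun j => c j • (hh.memLp j).toLp (h j)]
    with s h1 h2
  rw [h2, Finset.sum_apply]
  exact Finset.sum_congr rfl fun j _ => h1 j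

lemma gaussSup_mono (f : M → X) {E E' : Set M} (hE' : MeasurableSet E') (h : E' ⊆ E) :
    gaussSup μ f E' ≤ gaussSup μ f E := by
  refine iSup_le fun m => iSup₂_le fun h hh => ?_
  have ht : IsTestFamily μ f fun j => E'.indicator (h j) := by
    refine ⟨fun j => (hh.memLp j).indicator hE', fun j => ?_, fun c => ?_⟩
    · simpa only [indicator_smul_left] using (hh.integrable j).indicator hE'
    · refine le_trans (eLpNorm_mono fun s => ?_) (hh.eLpNorm_le c)
      by_cases hs : s ∈ E' <;> simp [hs]
  refine le_trans (le_of_eq ?_) (ht.gaussSumNorm_le E)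
  congr 1
  funext j
  simp_rw [← indicator_smul_apply_left]
  rw [setIntegral_indicator hE', inter_eq_right.2 ‹_›]

/-- For a fixed test family the integrals over `E a` depend continuously on `a`, by dominated
convergence, and a supremum of lower semicontinuous functions is lower semicontinuous. -/
lemma lowerSemicontinuous_gaussSup {α : Type*} [TopologicalSpace α] [FirstCountableTopology α]
    (f : M → X) {E : α → Set M} (hE : ∀ a, MeasurableSet (E a))
    (hEc : ∀ a, ∀ᵐ s ∂μ, ∀ᶠ b in 𝓝 a, (s ∈ E b ↔ s ∈ E a)) :
    LowerSemicontinuous fun a => gaussSup μ f (E a) := by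
  refine lowerSemicontinuous_iSup fun m => lowerSemicontinuous_iSup fun h =>
    lowerSemicontinuous_iSup fun hh => ?_
  refine lowerSemicontinuous_gaussSumNorm.comp (continuous_pi fun j => ?_)
  refine continuous_iff_continuousAt.2 fun a => ?_
  simp_rw [ContinuousAt, ← fun a => integral_indicator (μ := μ) (f := fun s => h j s • f s) (hE a)]
  refine tendsto_integral_filter_of_dominated_convergence (fun s => ‖h j s • f s‖)
    (Eventually.of_forall fun b => (hh.integrable j).1.indicator (hE b))
    (Eventually.of_forall fun b => ae_of_all _ fun s => norm_indicator_le_norm_self _ _)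
    (hh.integrable j).norm ?_
  filter_upwards [hEc a] with s hs
  refine tendsto_const_nhds.congr' ?_
  filter_upwards [hs] with b hb
  classical
  simp only [indicator_apply, hb]

end GaussSup

/-! ### Duality of Gauss norms for functions. -/

section GaussDuality

variable {M : Type*} [MeasurableSpace M] {μ : Measure M} {ι : Type*} [Fintype ι]
  {X : Type*} [NormedAddCommGroup X] [NormedSpace ℂ X]

/-- Functions with disjoint supports and norms at most `1` in `L²` form a contractive family. -/
lemma eLpNorm_sum_mul_le_of_disjoint {h : ι → M → ℂ} (hm : ∀ j, AEMeasurable (h j) μ)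
    (hd : ∀ s j k, h j s ≠ 0 → h k s ≠ 0 → j = k) (h1 : ∀ j, ∫⁻ s, ‖h j s‖ₑ ^ 2 ∂μ ≤ 1)
    (c : EuclideanSpace ℂ ι) : eLpNorm (fun s => ∑ j, c j * h j s) 2 μ ≤ ‖c‖ₑ := by
  have hp (s : M) : ‖∑ j, c j * h j s‖ₑ ^ 2 = ∑ j, ‖c j‖ₑ ^ 2 * ‖h j s‖ₑ ^ 2 := by
    by_cases hs : ∃ j, h j s ≠ 0
    · obtain ⟨j, hj⟩ := hs
      have h0 (k : ι) (hk : k ≠ j) : h k s = 0 := by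
        by_contra hne
        exact hk (hd s k j hne hj)
      rw [Finset.sum_eq_single j (fun k _ hk => by simp [h0 k hk]) (by simp),
        Finset.sum_eq_single j (fun k _ hk => by simp [h0 k hk]) (by simp), enorm_mul, mul_pow]
    · push Not at hs
      simp [hs]
  have hc : ‖c‖ₑ ^ 2 = ∑ j, ‖c j‖ₑ ^ 2 := by
    simp_rw [← ofReal_norm, ← ENNReal.ofReal_pow (norm_nonneg _)]
    rw [EuclideanSpace.norm_sq_eq, ENNReal.ofReal_sum_of_nonneg fun j _ => by positivity]
  rw [eLpNorm_eq_lintegral_rpow_enorm_toReal (by norm_num) (by norm_num)]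
  simp_rw [ENNReal.toReal_ofNat, ENNReal.rpow_ofNat, hp]
  rw [one_div, ENNReal.rpow_inv_le_iff (by norm_num), ENNReal.rpow_ofNat, hc,
    lintegral_finsetSum' _ fun j _ => ((hm j).enorm.pow_const 2).const_mul _]
  refine Finset.sum_le_sum fun j _ => ?_
  rw [lintegral_const_mul'' _ ((hm j).enorm.pow_const 2)]
  exact mul_le_of_le_one_right' (h1 j)

lemma isTestFamily_indicator {f : M → X} {θ : M → ℂ} (hθ : Measurable θ) (hθ1 : ∀ s, ‖θ s‖ ≤ 1)
    {A : ι → Set M} (hA : ∀ j, MeasurableSet (A j)) (hd : Pairwise fun j k => Disjoint (A j) (A k))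
    (hf : ∀ j, IntegrableOn f (A j) μ) (hμ : ∀ j, μ (A j) ≠ ⊤) :
    IsTestFamily μ f fun j => (A j).indicator fun s => ((√(μ.real (A j)))⁻¹ : ℂ) * θ s := by
  have hm (j : ι) : Measurable ((A j).indicator fun s => ((√(μ.real (A j)))⁻¹ : ℂ) * θ s) :=
    (hθ.const_mul _).indicator (hA j)
  have hsq (j : ι) :
      ∫⁻ s, ‖(A j).indicator (fun s => ((√(μ.real (A j)))⁻¹ : ℂ) * θ s) s‖ₑ ^ 2 ∂μ ≤ 1 := by
    calc
      _ ≤ ∫⁻ s, (A j).indicator (fun _ => ENNReal.ofReal (μ.real (A j))⁻¹) s ∂μ := by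
        refine lintegral_mono fun s => ?_
        by_cases hs : s ∈ A j
        · simp only [indicator_of_mem hs]
          rw [← ofReal_norm, ← ENNReal.ofReal_pow (norm_nonneg _)]
          refine ENNReal.ofReal_le_ofReal ?_
          rw [norm_mul, mul_pow, norm_inv, Complex.norm_real, Real.norm_eq_abs, inv_pow, sq_abs,
            Real.sq_sqrt measureReal_nonneg]
          exact mul_le_of_le_one_right (by positivity) (pow_le_one₀ (norm_nonneg _) (hθ1 s))
        · simp [hs]
      _ ≤ 1 := by
        rw [lintegral_indicator_const (hA j), ← ofReal_measureReal (hμ j),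
          ← ENNReal.ofReal_mul (by positivity), ← ENNReal.ofReal_one]
        -- On a null piece the factor is `0⁻¹ = 0`, so only `≤ 1` holds in general.
        exact ENNReal.ofReal_le_ofReal (inv_mul_le_one)
  refine ⟨fun j => ⟨(hm j).aestronglyMeasurable, ?_⟩, fun j => ?_,
    eLpNorm_sum_mul_le_of_disjoint (fun j => (hm j).aemeasurable) (fun s j k hj hk => ?_) hsq⟩
  · rw [eLpNorm_eq_lintegral_rpow_enorm_toReal (by norm_num) (by norm_num)]
    simp_rw [ENNReal.toReal_ofNat, ENNReal.rpow_ofNat]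
    exact ENNReal.rpow_lt_top_of_nonneg (by norm_num) ((hsq j).trans_lt ENNReal.one_lt_top).ne
  · simp_rw [← indicator_smul_apply_left]
    rw [integrable_indicator_iff (hA j)]
    refine (hf j).bdd_smul ‖((√(μ.real (A j)))⁻¹ : ℂ)‖
      (hθ.const_mul _).aestronglyMeasurable (ae_of_all _ fun s => ?_)
    rw [norm_mul]
    exact mul_le_of_le_one_right (norm_nonneg _) (hθ1 s)
  · by_contra hjk
    exact disjoint_left.1 (hd hjk) (mem_of_indicator_ne_zero hj) (mem_of_indicator_ne_zero hk)

/-- The product of the integrals over `μ(A)` is the integral of `g` applied to the mean of `f`. That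
mean and `f` are both within `ε` of `x`, whence `2 * ε`. -/
lemma norm_integral_apply_sub_le {f : M → X} {g : M → StrongDual ℂ X} [CompleteSpace X]
    {A : Set M} (hA : MeasurableSet A) (hμ : μ A ≠ ⊤) (hf : IntegrableOn f A μ)
    (hg : IntegrableOn g A μ) {R ε : ℝ} (hR0 : 0 ≤ R) (hR : ∀ s ∈ A, ‖g s‖ ≤ R)
    {x : X} (hε : ∀ s ∈ A, ‖f s - x‖ ≤ ε) :
    ‖(∫ s in A, g s (f s) ∂μ) -
      (μ.real A : ℂ)⁻¹ * (∫ s in A, g s ∂μ) (∫ s in A, f s ∂μ)‖ ≤ R * (2 * ε) * μ.real A := by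
  by_cases h0 : μ A = 0
  · simp [Measure.restrict_eq_zero.2 h0, measureReal_def, h0]
  have hpos : 0 < μ.real A := ENNReal.toReal_pos h0 hμ
  set x' : X := (μ.real A : ℂ)⁻¹ • ∫ s in A, f s ∂μ with hx'
  have hxx : ‖x - x'‖ ≤ ε := by
    have hc : IntegrableOn (fun _ => x) A μ := integrableOn_const hμ
    have h1 : ∫ s in A, (x - f s) ∂μ = (μ.real A : ℂ) • (x - x') := by
      rw [integral_sub hc hf, setIntegral_const, smul_sub, hx', smul_smul,
        mul_inv_cancel₀ (by exact_mod_cast hpos.ne'), one_smul, Complex.coe_smul]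
    have h2 : ‖∫ s in A, (x - f s) ∂μ‖ ≤ ε * μ.real A :=
      norm_setIntegral_le_of_norm_le_const hμ.lt_top fun s hs => by
        rw [norm_sub_rev]
        exact hε s hs
    rw [h1, norm_smul, Complex.norm_real, Real.norm_of_nonneg hpos.le, mul_comm] at h2
    exact le_of_mul_le_mul_right h2 hpos
  have hgf : IntegrableOn (fun s => g s (f s)) A μ := by
    refine (hf.norm.const_mul R).mono' (isBoundedBilinearMap_apply.continuous.comp_aestronglyMeasurable
      (hg.1.prodMk hf.1)) ((ae_restrict_mem hA).mono fun s hs => ?_)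
    exact (g s).le_of_opNorm_le (hR s hs) _
  have hgx : IntegrableOn (fun s => g s x') A μ := hg.apply_continuousLinearMap x'
  have h3 : (μ.real A : ℂ)⁻¹ * (∫ s in A, g s ∂μ) (∫ s in A, f s ∂μ) = ∫ s in A, g s x' ∂μ := by
    rw [← ContinuousLinearMap.integral_apply hg, hx', map_smul, smul_eq_mul]
  rw [h3, ← integral_sub hgf hgx]
  refine norm_setIntegral_le_of_norm_le_const hμ.lt_top fun s hs => ?_
  rw [← map_sub]
  refine ((g s).le_of_opNorm_le (hR s hs) _).trans (mul_le_mul_of_nonneg_left ?_ hR0)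
  calc
    ‖f s - x'‖ ≤ ‖f s - x‖ + ‖x - x'‖ := norm_sub_le_norm_sub_add_norm_sub _ _ _
    _ ≤ 2 * ε := by linarith [hε s hs]

lemma exists_measurable_phase {z : M → ℂ} (hz : Measurable z) :
    ∃ θ : M → ℂ, Measurable θ ∧ (∀ s, ‖θ s‖ ≤ 1) ∧ ∀ s, θ s * z s = (‖z s‖ : ℂ) := by
  -- Division by zero gives phase `0` at the zeros of `z`.
  refine ⟨fun s => starRingEnd ℂ (z s) / (‖z s‖ : ℂ), ?_, fun s => ?_, fun s => ?_⟩
  · exact (Complex.continuous_conj.measurable.comp hz).div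
      (Complex.measurable_ofReal.comp hz.norm)
  · simpa using div_self_le_one ‖z s‖
  · by_cases h : z s = 0
    · simp [h]
    · rw [div_mul_eq_mul_div, Complex.conj_mul', sq, mul_div_assoc, div_self (by simpa using h),
        mul_one]

/-- A set can be partitioned into countably many pieces on which `f` has small oscillation. -/
lemma exists_partition_small_oscillation {Y : Type*} [NormedAddCommGroup Y] {f : M → Y}
    (hf : StronglyMeasurable f) {S : Set M}
    (hS : MeasurableSet S) {ε : ℝ} (hε : 0 < ε) :
    ∃ (A : ℕ → Set M) (x : ℕ → Y), (∀ i, MeasurableSet (A i)) ∧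
      (Pairwise fun i j => Disjoint (A i) (A j)) ∧ ⋃ i, A i = S ∧
        ∀ i, ∀ s ∈ A i, ‖f s - x i‖ ≤ ε := by
  obtain ⟨c, hc, hcd⟩ := hf.isSeparable_range
  obtain ⟨x, hx⟩ := (hc.insert 0).exists_eq_range (insert_nonempty 0 c)
  let B : ℕ → Set M := fun i => {s | ‖f s - x i‖ ≤ ε}
  have hB (i : ℕ) : MeasurableSet (B i) :=
    measurableSet_le (hf.sub stronglyMeasurable_const).norm.measurable measurable_const
  refine ⟨fun i => S ∩ disjointed B i, x, fun i => hS.inter (.disjointed hB i),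
    fun i j hij => ((disjoint_disjointed B) hij).mono inter_subset_right inter_subset_right, ?_,
    fun i s hs => disjointed_subset B i hs.2⟩
  rw [← inter_iUnion, iUnion_disjointed, inter_eq_left]
  intro s _
  obtain ⟨y, hy, hys⟩ := Metric.mem_closure_iff.1 (hcd (mem_range_self s)) ε hε
  obtain ⟨i, rfl⟩ : y ∈ range x := hx ▸ mem_insert_of_mem 0 hy
  exact mem_iUnion.2 ⟨i, by simpa [B, dist_eq_norm] using hys.le⟩

/-- The normalised indicators of the pieces are a test family for `f`; multiplied by the phase of
`⟨f,g⟩` they are one for `g`. The finite duality then bounds the sum of the products of means, and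
small oscillation controls the error. -/
lemma setLIntegral_apply_le_add [CompleteSpace X] {f : M → X} {g : M → StrongDual ℂ X}
    (hf : StronglyMeasurable f) (hg : StronglyMeasurable g) {E S : Set M} (hS : MeasurableSet S)
    (hSE : S ⊆ E) (hμ : μ S ≠ ⊤) {R : ℝ} (hR0 : 0 ≤ R) (hfR : ∀ s ∈ S, ‖f s‖ ≤ R)
    (hgR : ∀ s ∈ S, ‖g s‖ ≤ R) {ε : ℝ} (hε : 0 < ε) :
    ∫⁻ s in S, ‖g s (f s)‖ₑ ∂μ ≤
      gaussSup μ f E * gaussSup μ g E + ENNReal.ofReal (R * (2 * ε) * μ.real S) := by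
  have hz : StronglyMeasurable fun s => g s (f s) :=
    isBoundedBilinearMap_apply.continuous.comp_stronglyMeasurable (hg.prodMk hf)
  obtain ⟨θ, hθ, hθ1, hθz⟩ := exists_measurable_phase hz.measurable
  obtain ⟨A, x, hA, hAd, hAS, hAx⟩ := exists_partition_small_oscillation hf hS hε
  have hsub (i : ℕ) : A i ⊆ S := hAS ▸ subset_iUnion A i
  have hμA (i : ℕ) : μ (A i) ≠ ⊤ := measure_ne_top_of_subset (hsub i) hμ
  have hfA (i : ℕ) : IntegrableOn f (A i) μ :=
    Measure.integrableOn_of_bounded (hμA i) hf.aestronglyMeasurable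
      ((ae_restrict_mem (hA i)).mono fun s hs => hfR s (hsub i hs))
  have hgA (i : ℕ) : IntegrableOn g (A i) μ :=
    Measure.integrableOn_of_bounded (hμA i) hg.aestronglyMeasurable
      ((ae_restrict_mem (hA i)).mono fun s hs => hgR s (hsub i hs))
  have hθg (s : M) (hs : s ∈ S) : ‖θ s • g s‖ ≤ R := by
    rw [norm_smul]
    exact (mul_le_of_le_one_left (norm_nonneg _) (hθ1 s)).trans (hgR s hs)
  have hθgA (i : ℕ) : IntegrableOn (fun s => θ s • g s) (A i) μ :=
    Measure.integrableOn_of_bounded (hμA i) (hθ.stronglyMeasurable.smul hg).aestronglyMeasurable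
      ((ae_restrict_mem (hA i)).mono fun s hs => hθg s (hsub i hs))
  have hzA (i : ℕ) : IntegrableOn (fun s => g s (f s)) (A i) μ :=
    Measure.integrableOn_of_bounded (M := R * R) (hμA i) hz.aestronglyMeasurable
      ((ae_restrict_mem (hA i)).mono fun s hs => (g s).le_of_opNorm_le_of_le
        (hgR s (hsub i hs)) (hfR s (hsub i hs)))
  rw [← hAS, lintegral_iUnion hA hAd, hAS]
  refine ENNReal.tsum_le_of_sum_range_le fun N => ?_
  have hd : Pairwise fun i j : Fin N => Disjoint (A i) (A j) := fun i j hij =>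
    hAd (Fin.val_injective.ne hij)
  have hint {Y : Type _} [NormedAddCommGroup Y] [NormedSpace ℂ Y] (φ : M → ℂ) (u : M → Y) (i : ℕ) :
      ∫ s in E, (A i).indicator (fun s => ((√(μ.real (A i)))⁻¹ : ℂ) * φ s) s • u s ∂μ =
        ((√(μ.real (A i)))⁻¹ : ℂ) • ∫ s in A i, φ s • u s ∂μ := by
    simp_rw [← indicator_smul_apply_left]
    rw [setIntegral_indicator (hA i), inter_eq_right.2 ((hsub i).trans hSE), ← integral_smul]
    simp_rw [mul_smul]
  have hf1 : gaussSumNorm (fun i : Fin N => ((√(μ.real (A i)))⁻¹ : ℂ) • ∫ s in A i, f s ∂μ) ≤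
      gaussSup μ f E := by
    refine le_trans (le_of_eq (congrArg gaussSumNorm (funext fun i => ?_)))
      ((isTestFamily_indicator (f := f) (θ := fun _ => 1) measurable_const (by simp)
        (fun i : Fin N => hA i) hd (fun i => hfA i) fun i => hμA i).gaussSumNorm_le E)
    have h := hint (fun _ => 1) f i
    simp_rw [one_smul] at h
    exact h.symm
  have hg1 : gaussSumNorm
      (fun i : Fin N => ((√(μ.real (A i)))⁻¹ : ℂ) • ∫ s in A i, θ s • g s ∂μ) ≤ gaussSup μ g E :=
    le_trans (le_of_eq (congrArg gaussSumNorm (funext fun i => (hint θ g i).symm)))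
      ((isTestFamily_indicator (f := g) hθ hθ1 (fun i : Fin N => hA i) hd (fun i => hgA i)
        fun i => hμA i).gaussSumNorm_le E)
  have hdual := (enorm_sum_apply_le_gaussSumNorm_mul _ _).trans (mul_le_mul' hf1 hg1)
  -- The two normalisations multiply to the factor `1/μ(A i)` of `norm_integral_apply_sub_le`.
  have hk (i : ℕ) : ((√(μ.real (A i)))⁻¹ : ℂ) * ((√(μ.real (A i)))⁻¹ : ℂ) =
      (μ.real (A i) : ℂ)⁻¹ := by
    rw [← mul_inv, ← Complex.ofReal_mul, Real.mul_self_sqrt measureReal_nonneg]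
  have hsum : ∑ i ∈ Finset.range N, ∫⁻ s in A i, ‖g s (f s)‖ₑ ∂μ =
      ‖∑ i : Fin N, ∫ s in A i, (θ s • g s) (f s) ∂μ‖ₑ := by
    have h1 (i : ℕ) : ∫ s in A i, (θ s • g s) (f s) ∂μ = ((∫ s in A i, ‖g s (f s)‖ ∂μ : ℝ) : ℂ) := by
      simp_rw [smul_apply, smul_eq_mul, hθz]
      exact integral_complex_ofReal
    simp_rw [h1]
    rw [← Complex.ofReal_sum, ← ofReal_norm, Complex.norm_real, Real.norm_of_nonneg
      (Finset.sum_nonneg fun i _ => integral_nonneg fun s => norm_nonneg _),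
      ENNReal.ofReal_sum_of_nonneg fun i _ => integral_nonneg fun s => norm_nonneg _,
      Finset.sum_range]
    exact Finset.sum_congr rfl fun i _ => (ofReal_integral_norm_eq_lintegral_enorm (hzA i)).symm
  rw [hsum]
  have hdiff : ‖(∑ i : Fin N, ∫ s in A i, (θ s • g s) (f s) ∂μ) -
      ∑ i : Fin N, (((√(μ.real (A i)))⁻¹ : ℂ) • ∫ s in A i, θ s • g s ∂μ)
        (((√(μ.real (A i)))⁻¹ : ℂ) • ∫ s in A i, f s ∂μ)‖ₑ ≤
      ENNReal.ofReal (R * (2 * ε) * μ.real S) := by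
    rw [← ofReal_norm, ← Finset.sum_sub_distrib]
    refine ENNReal.ofReal_le_ofReal ((norm_sum_le _ _).trans ?_)
    calc
      _ ≤ ∑ i : Fin N, R * (2 * ε) * μ.real (A i) := by
        refine Finset.sum_le_sum fun i _ => ?_
        rw [smul_apply, map_smul, smul_smul, hk, smul_eq_mul]
        exact norm_integral_apply_sub_le (hA i) (hμA i) (hfA i) (hθgA i) hR0
          (fun s hs => hθg s (hsub i hs)) (hAx i)
      _ ≤ R * (2 * ε) * μ.real S := by
        rw [← Finset.mul_sum, ← measureReal_biUnion_finset (fun i _ j _ hij => hd hij)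
          (fun i _ => hA i) fun i _ => hμA i]
        refine mul_le_mul_of_nonneg_left (measureReal_mono ?_ hμ) (by positivity)
        exact iUnion₂_subset fun i _ => hsub i
  refine le_trans ?_ (add_le_add hdual hdiff)
  refine le_trans (le_of_eq ?_) (enorm_add_le _ _)
  rw [add_sub_cancel]

lemma setLIntegral_apply_le_of_bounded [CompleteSpace X] {f : M → X} {g : M → StrongDual ℂ X}
    (hf : StronglyMeasurable f) (hg : StronglyMeasurable g) {E S : Set M} (hS : MeasurableSet S)
    (hSE : S ⊆ E) (hμ : μ S ≠ ⊤) {R : ℝ} (hR0 : 0 ≤ R) (hfR : ∀ s ∈ S, ‖f s‖ ≤ R)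
    (hgR : ∀ s ∈ S, ‖g s‖ ≤ R) :
    ∫⁻ s in S, ‖g s (f s)‖ₑ ∂μ ≤ gaussSup μ f E * gaussSup μ g E := by
  have h : Tendsto (fun ε : ℝ => gaussSup μ f E * gaussSup μ g E +
      ENNReal.ofReal (R * (2 * ε) * μ.real S)) (𝓝[>] 0)
      (𝓝 (gaussSup μ f E * gaussSup μ g E + ENNReal.ofReal (R * (2 * 0) * μ.real S))) := by
    refine tendsto_const_nhds.add (ENNReal.tendsto_ofReal (Tendsto.mono_left ?_ nhdsWithin_le_nhds))
    exact Continuous.tendsto (by fun_prop) 0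
  simp only [mul_zero, zero_mul, ENNReal.ofReal_zero, add_zero] at h
  refine ge_of_tendsto h ?_
  filter_upwards [self_mem_nhdsWithin] with ε hε
  exact setLIntegral_apply_le_add hf hg hS hSE hμ hR0 hfR hgR hε

lemma gaussSup_congr_ae {f f' : M → X} (h : f =ᵐ[μ] f') (E : Set M) :
    gaussSup μ f E = gaussSup μ f' E := by
  suffices H : ∀ {f f' : M → X}, f =ᵐ[μ] f' → gaussSup μ f E ≤ gaussSup μ f' E from
    le_antisymm (H h) (H h.symm)
  intro f f' h
  refine iSup_le fun m => iSup₂_le fun u hu => ?_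
  have h1 (j : Fin m) : (fun s => u j s • f s) =ᵐ[μ] fun s => u j s • f' s :=
    h.mono fun s hs => by simp only [hs]
  have hu' : IsTestFamily μ f' u := ⟨hu.memLp, fun j => (hu.integrable j).congr (h1 j), hu.eLpNorm_le⟩
  refine le_trans (le_of_eq ?_) (hu'.gaussSumNorm_le E)
  congr 1
  funext j
  exact integral_congr_ae (ae_restrict_of_ae (h1 j))

/-- The duality inequality for Gauss norms. -/
lemma setLIntegral_apply_le [SigmaFinite μ] [CompleteSpace X] {f : M → X} {g : M → StrongDual ℂ X}
    (hf : AEStronglyMeasurable f μ) (hg : AEStronglyMeasurable g μ) {E : Set M}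
    (hE : MeasurableSet E) :
    ∫⁻ s in E, ‖g s (f s)‖ₑ ∂μ ≤ gaussSup μ f E * gaussSup μ g E := by
  rw [gaussSup_congr_ae hf.ae_eq_mk, gaussSup_congr_ae hg.ae_eq_mk]
  set f' := hf.mk f
  set g' := hg.mk g
  have hfm : StronglyMeasurable f' := hf.stronglyMeasurable_mk
  have hgm : StronglyMeasurable g' := hg.stronglyMeasurable_mk
  have h1 : ∫⁻ s in E, ‖g s (f s)‖ₑ ∂μ = ∫⁻ s in E, ‖g' s (f' s)‖ₑ ∂μ := by
    refine lintegral_congr_ae (ae_restrict_of_ae ?_)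
    filter_upwards [hf.ae_eq_mk, hg.ae_eq_mk] with s hs hs'
    rw [hs, hs']
  -- Exhaustion of `E` by sets of finite measure on which both functions are bounded.
  let S : ℕ → Set M := fun k => (E ∩ spanningSets μ k) ∩ {s | ‖f' s‖ ≤ k} ∩ {s | ‖g' s‖ ≤ k}
  have hS : ⋃ k, S k = E := by
    refine subset_antisymm (iUnion_subset fun k s hs => hs.1.1.1) fun s hs => ?_
    obtain ⟨k₁, hk₁⟩ := exists_nat_ge ‖f' s‖
    obtain ⟨k₂, hk₂⟩ := exists_nat_ge ‖g' s‖
    have hsp : s ∈ ⋃ k, spanningSets μ k := by simp [iUnion_spanningSets]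
    obtain ⟨k₃, hk₃⟩ := mem_iUnion.1 hsp
    refine mem_iUnion.2 ⟨max k₁ (max k₂ k₃), ⟨⟨hs, monotone_spanningSets μ (by simp) hk₃⟩, ?_⟩, ?_⟩
    · exact hk₁.trans (by simp)
    · exact hk₂.trans (by simp)
  have hmono : Monotone S := fun k l hkl s hs =>
    ⟨⟨⟨hs.1.1.1, monotone_spanningSets μ hkl hs.1.1.2⟩,
      (show ‖f' s‖ ≤ k from hs.1.2).trans (Nat.cast_le.2 hkl)⟩,
      (show ‖g' s‖ ≤ k from hs.2).trans (Nat.cast_le.2 hkl)⟩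
  have hSm (k : ℕ) : MeasurableSet (S k) :=
    ((hE.inter (measurableSet_spanningSets μ k)).inter
      (measurableSet_le hfm.norm.measurable measurable_const)).inter
      (measurableSet_le hgm.norm.measurable measurable_const)
  rw [h1]
  nth_rewrite 1 [← hS]
  rw [setLIntegral_iUnion_of_directed _ hmono.directed_le]
  refine iSup_le fun k => setLIntegral_apply_le_of_bounded hfm hgm (hSm k) (fun s hs => hs.1.1.1)
    (measure_ne_top_of_subset (fun s hs => hs.1.1.2) (measure_spanningSets_lt_top μ k).ne)
    k.cast_nonneg (fun s hs => hs.1.2) fun s hs => hs.2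

end GaussDuality

/-! ### Cones, stopping heights and the averaging argument. -/

section Cones

variable {n : ℕ}

lemma measurableSet_upperHalfSpace : MeasurableSet (upperHalfSpace n) :=
  measurableSet_lt measurable_const measurable_snd

lemma measurable_coneMeasure_density :
    Measurable fun p : EuclideanSpace ℝ (Fin n) × ℝ => (ENNReal.ofReal (p.2 ^ (n + 1)))⁻¹ := by
  fun_prop

lemma coneMeasure_absolutelyContinuous :
    coneMeasure n ≪ volume.restrict (upperHalfSpace n) :=
  withDensity_absolutelyContinuous _ _

lemma coneMeasure_absolutelyContinuous_volume :
    coneMeasure n ≪ (volume : Measure (EuclideanSpace ℝ (Fin n) × ℝ)) :=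
  coneMeasure_absolutelyContinuous.trans Measure.restrict_le_self.absolutelyContinuous

instance sigmaFinite_coneMeasure : SigmaFinite (coneMeasure n) := by
  refine SigmaFinite.withDensity_of_ne_top ?_
  filter_upwards [ae_restrict_mem measurableSet_upperHalfSpace] with p hp
  simpa using pow_pos hp (n + 1)

lemma lintegral_div_eq_lintegral_coneMeasure (φ : EuclideanSpace ℝ (Fin n) × ℝ → ℝ≥0∞)
    (hφ : AEMeasurable φ (volume.restrict (upperHalfSpace n))) :
    ∫⁻ p in upperHalfSpace n, φ p / ENNReal.ofReal p.2 =
      ∫⁻ p, φ p * ENNReal.ofReal (p.2 ^ n) ∂coneMeasure n := by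
  rw [coneMeasure, lintegral_withDensity_eq_lintegral_mul₀ measurable_coneMeasure_density.aemeasurable
    (g := fun p => φ p * ENNReal.ofReal (p.2 ^ n)) (hφ.mul (by fun_prop))]
  refine setLIntegral_congr_fun measurableSet_upperHalfSpace fun p hp => ?_
  have hp : 0 < p.2 := hp
  have h1 : ENNReal.ofReal (p.2 ^ n) ≠ 0 := by simpa using pow_pos hp n
  have h2 : ENNReal.ofReal p.2 ≠ 0 := by simpa using hp
  simp only [Pi.mul_apply]
  rw [pow_succ, ENNReal.ofReal_mul (by positivity), ENNReal.mul_inv (.inl h1) (.inl (by simp)),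
    div_eq_mul_inv, mul_comm (_ * _) (φ p * _), mul_assoc, ← mul_assoc (ENNReal.ofReal (p.2 ^ n)),
    ENNReal.mul_inv_cancel h1 (by simp), one_mul]

lemma measurableSet_cone (x : EuclideanSpace ℝ (Fin n)) : MeasurableSet (cone x) :=
  (measurableSet_lt measurable_const measurable_snd).inter
    (measurableSet_lt (by fun_prop) measurable_snd)

lemma measurableSet_truncCone (x : EuclideanSpace ℝ (Fin n)) (h : ℝ) :
    MeasurableSet (truncCone x h) :=
  (measurableSet_cone x).inter (measurableSet_lt measurable_snd measurable_const)

lemma truncCone_subset_cone (x : EuclideanSpace ℝ (Fin n)) (h : ℝ) : truncCone x h ⊆ cone x :=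
  fun _ hp => hp.1

lemma truncCone_mono (x : EuclideanSpace ℝ (Fin n)) : Monotone (truncCone x) :=
  fun _ _ hh' _ hp => ⟨hp.1, hp.2.trans_le hh'⟩

lemma ae_coneMeasure_of_finite_slices {Z : Set (EuclideanSpace ℝ (Fin n) × ℝ)}
    (hZm : MeasurableSet Z) (hZ : ∀ y, (Prod.mk y ⁻¹' Z).Finite) : ∀ᵐ p ∂coneMeasure n, p ∉ Z := by
  refine coneMeasure_absolutelyContinuous_volume.ae_le (measure_eq_zero_iff_ae_notMem.1 ?_)
  rw [Measure.volume_eq_prod, Measure.measure_prod_null hZm]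
  exact ae_of_all _ fun y => (hZ y).measure_zero _

lemma ae_eventually_mem_truncCone_iff (a : EuclideanSpace ℝ (Fin n) × ℝ) :
    ∀ᵐ p ∂coneMeasure n, ∀ᶠ b in 𝓝 a, (p ∈ truncCone b.1 b.2 ↔ p ∈ truncCone a.1 a.2) := by
  -- Membership can jump only on the lateral surface and the top, which meet each vertical line in
  -- at most two points.
  have hZ : ∀ᵐ p ∂coneMeasure n, p ∉ {p | ‖p.1 - a.1‖ = p.2} ∪ {p | p.2 = a.2} := by
    refine ae_coneMeasure_of_finite_slices ((measurableSet_eq_fun (by fun_prop) measurable_snd).union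
      (measurableSet_eq_fun measurable_snd measurable_const)) fun y => ?_
    refine (toFinite {‖y - a.1‖, a.2}).subset fun s hs => ?_
    rcases hs with hs | hs
    · exact .inl (Eq.symm hs)
    · exact .inr hs
  filter_upwards [hZ] with p hp
  have h1 : ‖p.1 - a.1‖ ≠ p.2 := fun h => hp (.inl h)
  have h2 : p.2 ≠ a.2 := fun h => hp (.inr h)
  have c1 : Continuous fun b : EuclideanSpace ℝ (Fin n) × ℝ => ‖p.1 - b.1‖ := by fun_prop
  have e1 : ∀ᶠ b in 𝓝 a, (‖p.1 - b.1‖ < p.2 ↔ ‖p.1 - a.1‖ < p.2) := by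
    rcases h1.lt_or_gt with h | h
    · filter_upwards [(c1.tendsto a).eventually_lt_const h] with b hb using iff_of_true hb h
    · filter_upwards [(c1.tendsto a).eventually_const_lt h] with b hb
        using iff_of_false hb.not_gt h.not_gt
  have e2 : ∀ᶠ b in 𝓝 a, (p.2 < b.2 ↔ p.2 < a.2) := by
    rcases h2.lt_or_gt with h | h
    · filter_upwards [(continuous_snd.tendsto a).eventually_const_lt h] with b hb
        using iff_of_true hb h
    · filter_upwards [(continuous_snd.tendsto a).eventually_lt_const h] with b hb
        using iff_of_false hb.not_gt h.not_gt
  filter_upwards [e1, e2] with b hb1 hb2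
  simp only [truncCone, cone, mem_ofPred_eq, hb1, hb2]

lemma volume_ball_eq_mul (y : EuclideanSpace ℝ (Fin n)) {t : ℝ} (ht : 0 < t) :
    volume (Metric.ball y t) =
      ENNReal.ofReal (t ^ n) * volume (Metric.ball (0 : EuclideanSpace ℝ (Fin n)) 1) := by
  simpa using Measure.addHaar_ball_of_pos volume y ht

variable {X : Type*} [NormedAddCommGroup X] [NormedSpace ℂ X]

/-- Lower semicontinuous minorant of `functionalATrunc`. -/
def coneSup (F : EuclideanSpace ℝ (Fin n) × ℝ → X) (x : EuclideanSpace ℝ (Fin n)) (h : ℝ) : ℝ≥0∞ :=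
  gaussSup (coneMeasure n) F (truncCone x h)

lemma coneSup_le_functionalATrunc [CompleteSpace X] (F : EuclideanSpace ℝ (Fin n) × ℝ → X)
    (x : EuclideanSpace ℝ (Fin n)) (h : ℝ) : coneSup F x h ≤ functionalATrunc F h x :=
  gaussSup_le_gaussNorm F (measurableSet_truncCone x h)

lemma coneSup_mono (F : EuclideanSpace ℝ (Fin n) × ℝ → X) (x : EuclideanSpace ℝ (Fin n)) :
    Monotone (coneSup F x) :=
  fun _ _ hh' => gaussSup_mono F (measurableSet_truncCone x _) (truncCone_mono x hh')

lemma measurable_coneSup (F : EuclideanSpace ℝ (Fin n) × ℝ → X) :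
    Measurable fun a : EuclideanSpace ℝ (Fin n) × ℝ => coneSup F a.1 a.2 := by
  have h := lowerSemicontinuous_gaussSup (μ := coneMeasure n) F
    (E := fun a : EuclideanSpace ℝ (Fin n) × ℝ => truncCone a.1 a.2)
    fun a => measurableSet_truncCone a.1 a.2
  exact (h ae_eventually_mem_truncCone_iff).measurable

/-- The supremum of the averages of `coneSup`, a lower semicontinuous minorant of `functionalC`. -/
def carlesonSup (q : ℝ) (F : EuclideanSpace ℝ (Fin n) × ℝ → X)
    (x : EuclideanSpace ℝ (Fin n)) : ℝ≥0∞ :=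
  ⨆ (c : EuclideanSpace ℝ (Fin n)) (r : ℝ) (_ : x ∈ Metric.ball c r),
    ((volume (Metric.ball c r))⁻¹ * ∫⁻ y in Metric.ball c r, coneSup F y r ^ q) ^ (1 / q)

lemma carlesonSup_le_functionalC [CompleteSpace X] {q : ℝ} (hq : 0 < q)
    (F : EuclideanSpace ℝ (Fin n) × ℝ → X) (x : EuclideanSpace ℝ (Fin n)) :
    carlesonSup q F x ≤ functionalC q F x := by
  refine iSup_mono fun c => iSup₂_mono fun r _ => ?_
  refine ENNReal.rpow_le_rpow (mul_le_mul_right (lintegral_mono fun y => ?_) _) (by positivity)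
  exact ENNReal.rpow_le_rpow (coneSup_le_functionalATrunc F y r) hq.le

/-- For each ball the contribution, as a function of `x`, is a constant on an open set and zero
elsewhere, hence lower semicontinuous. -/
lemma measurable_carlesonSup (q : ℝ) (F : EuclideanSpace ℝ (Fin n) × ℝ → X) :
    Measurable (carlesonSup q F) := by
  refine LowerSemicontinuous.measurable (lowerSemicontinuous_iSup fun c =>
    lowerSemicontinuous_iSup fun r => ?_)
  set v := ((volume (Metric.ball c r))⁻¹ * ∫⁻ y in Metric.ball c r, coneSup F y r ^ q) ^ (1 / q)
  have h : (fun x : EuclideanSpace ℝ (Fin n) => ⨆ _ : x ∈ Metric.ball c r, v) =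
      (Metric.ball c r).indicator fun _ => v := by
    funext x
    by_cases hx : x ∈ Metric.ball c r <;> simp only [hx, iSup_pos, iSup_neg, indicator_of_mem,
      indicator_of_notMem, not_false_eq_true, ENNReal.bot_eq_zero]
  rw [h]
  exact Metric.isOpen_ball.lowerSemicontinuous_indicator zero_le

/-- By Chebyshev's inequality, `coneSup F x t ≤ 2 ^ (1 / q) * carlesonSup q F x` holds on at least
half of each ball of radius `t`. -/
lemma volume_ball_le_two_mul {q : ℝ} (hq : 0 < q) (F : EuclideanSpace ℝ (Fin n) × ℝ → X)
    (y : EuclideanSpace ℝ (Fin n)) {t : ℝ} (ht : 0 < t) :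
    volume (Metric.ball y t) ≤ 2 * volume {x | x ∈ Metric.ball y t ∧
      coneSup F x t ≤ 2 ^ (1 / q) * carlesonSup q F x} := by
  set B := Metric.ball y t with hB
  set V := volume B with hV
  have hV0 : V ≠ 0 := (Metric.measure_ball_pos volume y ht).ne'
  have hVt : V ≠ ⊤ := measure_ball_lt_top.ne
  have hm : Measurable fun x => coneSup F x t ^ q :=
    ((measurable_coneSup F).comp (measurable_id.prodMk measurable_const)).pow_const q
  set I := ∫⁻ x in B, coneSup F x t ^ q with hI
  have hbad : volume (B ∩ {x | 2 * (V⁻¹ * I) < coneSup F x t ^ q}) ≤ V / 2 := by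
    rw [inter_comm, ← Measure.restrict_apply (measurableSet_lt measurable_const hm)]
    -- Chebyshev needs a threshold in `(0, ∞)`. At `0` the integrand vanishes almost everywhere; at
    -- `∞` the bad set is empty.
    by_cases hI0 : I = 0
    · have h0 : ∀ᵐ x ∂volume.restrict B, coneSup F x t ^ q = 0 := (lintegral_eq_zero_iff hm).1 hI0
      refine le_trans (le_of_eq ?_) zero_le
      refine measure_eq_zero_iff_ae_notMem.2 (h0.mono fun x hx hx' => ?_)
      rw [mem_ofPred_eq, hx] at hx'
      exact not_lt_zero hx'
    by_cases hIt : I = ⊤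
    · have h0 : 2 * (V⁻¹ * I) = ⊤ := by simp [hIt, hVt, ENNReal.mul_top]
      simp [h0]
    refine (measure_mono fun x hx => ?_).trans ((meas_ge_le_lintegral_div hm.aemeasurable
      (ε := 2 * (V⁻¹ * I)) ?_ ?_).trans_eq ?_)
    · exact (show 2 * (V⁻¹ * I) < coneSup F x t ^ q from hx).le
    · simp [hI0, hVt]
    · exact ENNReal.mul_ne_top (by simp) (ENNReal.mul_ne_top (by simpa using hV0) hIt)
    · rw [← hI, ENNReal.div_eq_inv_mul, ENNReal.mul_inv (by simp) (by simp),
        ENNReal.mul_inv (by simp [hVt]) (by simp [hV0]), inv_inv, mul_assoc, mul_assoc,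
        ENNReal.inv_mul_cancel hI0 hIt, mul_one, ENNReal.div_eq_inv_mul]
  have hcover : B ⊆ {x | x ∈ B ∧ coneSup F x t ≤ 2 ^ (1 / q) * carlesonSup q F x} ∪
      (B ∩ {x | 2 * (V⁻¹ * I) < coneSup F x t ^ q}) := by
    intro x hx
    by_cases h : 2 * (V⁻¹ * I) < coneSup F x t ^ q
    · exact .inr ⟨hx, h⟩
    · refine .inl ⟨hx, ?_⟩
      have h1 : coneSup F x t ≤ (2 * (V⁻¹ * I)) ^ (1 / q) := by
        rw [one_div, ENNReal.le_rpow_inv_iff hq]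
        exact not_lt.1 h
      rw [ENNReal.mul_rpow_of_nonneg _ _ (by positivity)] at h1
      refine h1.trans (mul_le_mul_right ?_ _)
      -- The ball `B(y,t)` contains `x`, and its radius is the truncation height `t`.
      exact le_iSup_of_le y (le_iSup₂_of_le t hx le_rfl)
  have h1 := (measure_mono hcover).trans (measure_union_le (μ := volume) _ _)
  have h2 := h1.trans (add_le_add le_rfl hbad)
  have h3 : V / 2 ≤ volume {x | x ∈ B ∧ coneSup F x t ≤ 2 ^ (1 / q) * carlesonSup q F x} := by
    have h4 : V / 2 + V / 2 ≤ _ := (ENNReal.add_halves V).trans_le h2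
    exact (ENNReal.add_le_add_iff_right (ENNReal.div_ne_top hVt (by simp))).1 h4
  calc
    V = 2 * (V / 2) := (ENNReal.mul_div_cancel (by simp) (by simp)).symm
    _ ≤ _ := mul_le_mul_right h3 _

lemma setLIntegral_stopped_cone_le [CompleteSpace X] {F : EuclideanSpace ℝ (Fin n) × ℝ → X}
    {G : EuclideanSpace ℝ (Fin n) × ℝ → StrongDual ℂ X}
    (hF : AEStronglyMeasurable F (coneMeasure n)) (hG : AEStronglyMeasurable G (coneMeasure n))
    (x : EuclideanSpace ℝ (Fin n)) (b : ℝ≥0∞) :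
    ∫⁻ p in {p | p ∈ cone x ∧ coneSup F x p.2 ≤ b}, ‖G p (F p)‖ₑ ∂coneMeasure n ≤
      b * gaussSup (coneMeasure n) G (cone x) := by
  set T : Set ℝ := {t | coneSup F x t ≤ b} with hT
  -- Truncation is strict, so a greatest good height would be missed by the union below; it occupies
  -- a single level, a null set. Rational heights keep the union countable.
  have hmax : ∀ᵐ p ∂coneMeasure n, ¬ IsGreatest T p.2 := by
    refine ae_coneMeasure_of_finite_slices (Z := {p | IsGreatest T p.2}) ?_ fun y => ?_
    · exact measurable_snd
        (Set.Subsingleton.measurableSet fun s hs t ht => IsGreatest.unique hs ht)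
    · exact Set.Subsingleton.finite fun s hs t ht => IsGreatest.unique hs ht
  have hcover : ({p | p ∈ cone x ∧ coneSup F x p.2 ≤ b} : Set _) ≤ᵐ[coneMeasure n]
      ⋃ r : {r : ℚ // (r : ℝ) ∈ T}, truncCone x r := by
    filter_upwards [hmax] with p hp hpx
    have hpT : p.2 ∈ T := hpx.2
    obtain ⟨t, ht, hpt⟩ : ∃ t ∈ T, p.2 < t := by
      by_contra! h
      exact hp ⟨hpT, h⟩
    obtain ⟨r, hr1, hr2⟩ := exists_rat_btwn hpt
    exact mem_iUnion.2 ⟨⟨r, (coneSup_mono F x hr2.le).trans ht⟩, hpx.1, hr1⟩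
  refine (lintegral_mono_set' hcover).trans ?_
  have hdir : Directed (· ⊆ ·) fun r : {r : ℚ // (r : ℝ) ∈ T} => truncCone x (r : ℝ) :=
    Monotone.directed_le fun r r' h => truncCone_mono x (by exact_mod_cast h)
  rw [setLIntegral_iUnion_of_directed _ hdir]
  refine iSup_le fun r => (setLIntegral_apply_le hF hG (measurableSet_truncCone x r)).trans ?_
  exact mul_le_mul' r.2 (gaussSup_mono G (measurableSet_truncCone x r) (truncCone_subset_cone x r))

lemma lintegral_mul_le_carlesonSup [CompleteSpace X] {q : ℝ} (hq : 0 < q)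
    {F : EuclideanSpace ℝ (Fin n) × ℝ → X} {G : EuclideanSpace ℝ (Fin n) × ℝ → StrongDual ℂ X}
    (hF : AEStronglyMeasurable F (coneMeasure n)) (hG : AEStronglyMeasurable G (coneMeasure n)) :
    ∫⁻ p, ‖G p (F p)‖ₑ * ENNReal.ofReal (p.2 ^ n) ∂coneMeasure n ≤
      2 * 2 ^ (1 / q) * (volume (Metric.ball (0 : EuclideanSpace ℝ (Fin n)) 1))⁻¹ *
        ∫⁻ x, carlesonSup q F x * gaussSup (coneMeasure n) G (cone x) := by
  set ω := volume (Metric.ball (0 : EuclideanSpace ℝ (Fin n)) 1) with hω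
  have hω0 : ω ≠ 0 := (Metric.measure_ball_pos volume _ one_pos).ne'
  have hωt : ω ≠ ⊤ := measure_ball_lt_top.ne
  set φ : EuclideanSpace ℝ (Fin n) × ℝ → ℝ≥0∞ := fun p => ‖G p (F p)‖ₑ with hφ
  have hφm : AEMeasurable φ (coneMeasure n) :=
    (isBoundedBilinearMap_apply.continuous.comp_aestronglyMeasurable (hG.prodMk hF)).enorm
  let W : Set (EuclideanSpace ℝ (Fin n) × (EuclideanSpace ℝ (Fin n) × ℝ)) :=
    {w | w.2 ∈ cone w.1 ∧ coneSup F w.1 w.2.2 ≤ 2 ^ (1 / q) * carlesonSup q F w.1}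
  have hW : MeasurableSet W := by
    have h1 : MeasurableSet {w : EuclideanSpace ℝ (Fin n) × (EuclideanSpace ℝ (Fin n) × ℝ) |
        0 < w.2.2} := measurableSet_lt measurable_const (by fun_prop)
    have h2 : MeasurableSet {w : EuclideanSpace ℝ (Fin n) × (EuclideanSpace ℝ (Fin n) × ℝ) |
        ‖w.2.1 - w.1‖ < w.2.2} := measurableSet_lt (by fun_prop) (by fun_prop)
    have h3 : Measurable fun w : EuclideanSpace ℝ (Fin n) × (EuclideanSpace ℝ (Fin n) × ℝ) =>
        coneSup F w.1 w.2.2 := by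
      have hm : Measurable fun w : EuclideanSpace ℝ (Fin n) × (EuclideanSpace ℝ (Fin n) × ℝ) =>
        (w.1, w.2.2) := by fun_prop
      have h := (measurable_coneSup F).comp hm
      exact h
    have h4 : Measurable fun w : EuclideanSpace ℝ (Fin n) × (EuclideanSpace ℝ (Fin n) × ℝ) =>
        2 ^ (1 / q) * carlesonSup q F w.1 :=
      ((measurable_carlesonSup q F).comp measurable_fst).const_mul _
    have h5 := (h1.inter h2).inter (measurableSet_le h3 h4)
    exact h5
  -- `t^n |B(0,1)|` is the volume of `B(y,t)`, at most twice that of its good points, which form the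
  -- slice of `W` at `p`.
  have hpt : ∀ᵐ p ∂coneMeasure n, φ p * ENNReal.ofReal (p.2 ^ n) ≤
      2 * ω⁻¹ * ∫⁻ x, W.indicator (fun w => φ w.2) (x, p) := by
    filter_upwards [coneMeasure_absolutelyContinuous.ae_le
      (ae_restrict_mem measurableSet_upperHalfSpace)] with p hp
    have h1 := volume_ball_le_two_mul hq F p.1 hp
    have h2 : ∫⁻ x, W.indicator (fun w => φ w.2) (x, p) =
        φ p * volume {x | x ∈ Metric.ball p.1 p.2 ∧
          coneSup F x p.2 ≤ 2 ^ (1 / q) * carlesonSup q F x} := by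
      have hS : MeasurableSet {x | (x, p) ∈ W} := measurable_prodMk_right hW
      have h3 : {x | x ∈ Metric.ball p.1 p.2 ∧
          coneSup F x p.2 ≤ 2 ^ (1 / q) * carlesonSup q F x} = {x | (x, p) ∈ W} := by
        ext x
        have hp : 0 < p.2 := hp
        simp [W, cone, hp, dist_eq_norm, norm_sub_rev]
      rw [h3, ← lintegral_indicator_const hS]
      rfl
    rw [h2]
    rw [volume_ball_eq_mul p.1 hp, ← hω] at h1
    calc
      φ p * ENNReal.ofReal (p.2 ^ n) = φ p * ω⁻¹ * (ENNReal.ofReal (p.2 ^ n) * ω) := by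
        rw [mul_comm (ENNReal.ofReal _) ω, mul_assoc, ← mul_assoc ω⁻¹,
          ENNReal.inv_mul_cancel hω0 hωt, one_mul]
      _ ≤ φ p * ω⁻¹ * _ := mul_le_mul_right h1 _
      _ = _ := by ring
  have hWφ : AEMeasurable (W.indicator fun w => φ w.2) (volume.prod (coneMeasure n)) :=
    (hφm.comp_quasiMeasurePreserving Measure.quasiMeasurePreserving_snd).indicator hW
  have hC : 2 * ω⁻¹ ≠ ⊤ := ENNReal.mul_ne_top (by simp) (by simpa using hω0)
  have hκ : (2 : ℝ≥0∞) ^ (1 / q) ≠ ⊤ := ENNReal.rpow_ne_top_of_nonneg (by positivity) (by simp)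
  calc
    _ ≤ ∫⁻ p, 2 * ω⁻¹ * (∫⁻ x, W.indicator (fun w => φ w.2) (x, p)) ∂coneMeasure n :=
      lintegral_mono_ae hpt
    _ = 2 * ω⁻¹ * ∫⁻ x, (∫⁻ p, W.indicator (fun w => φ w.2) (x, p) ∂coneMeasure n) := by
      rw [lintegral_const_mul' _ _ hC, lintegral_lintegral_swap (f := fun x p =>
        W.indicator (fun w => φ w.2) (x, p)) hWφ]
    _ ≤ 2 * ω⁻¹ * ∫⁻ x, 2 ^ (1 / q) * (carlesonSup q F x * gaussSup (coneMeasure n) G (cone x)) := by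
      refine mul_le_mul_right (lintegral_mono fun x => ?_) _
      rw [← mul_assoc]
      refine le_trans (le_of_eq ?_) (setLIntegral_stopped_cone_le hF hG x _)
      exact lintegral_indicator (measurable_prodMk_left hW) _
    _ = _ := by
      rw [lintegral_const_mul' _ _ hκ]
      ring

end Cones
end

theorem theorem4p6 (n : ℕ) (q : ℝ) (hq : 0 < q) :
    ∃ K : ℝ≥0, ∀ (X : Type*) [NormedAddCommGroup X] [NormedSpace ℂ X] [CompleteSpace X]
      (F : EuclideanSpace ℝ (Fin n) × ℝ → X)
      (G : EuclideanSpace ℝ (Fin n) × ℝ → StrongDual ℂ X)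
      (_ : AEStronglyMeasurable F (volume.restrict (upperHalfSpace n)))
      (_ : AEStronglyMeasurable G (volume.restrict (upperHalfSpace n))),
      ∫⁻ p in upperHalfSpace n, ‖G p (F p)‖ₑ / ENNReal.ofReal p.2
        ≤ K * ∫⁻ x : EuclideanSpace ℝ (Fin n), functionalC q F x * functionalA G x := by
  have hK : 2 * 2 ^ (1 / q) * (volume (Metric.ball (0 : EuclideanSpace ℝ (Fin n)) 1))⁻¹ ≠ ⊤ :=
    ENNReal.mul_ne_top (ENNReal.mul_ne_top (by simp)
      (ENNReal.rpow_ne_top_of_nonneg (by positivity) (by simp)))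
      (ENNReal.inv_ne_top.2 (Metric.measure_ball_pos volume _ one_pos).ne')
  refine ⟨ENNReal.toNNReal (2 * 2 ^ (1 / q) *
    (volume (Metric.ball (0 : EuclideanSpace ℝ (Fin n)) 1))⁻¹), fun X _ _ _ F G hF hG => ?_⟩
  rw [lintegral_div_eq_lintegral_coneMeasure _
    (isBoundedBilinearMap_apply.continuous.comp_aestronglyMeasurable (hG.prodMk hF)).enorm]
  refine (lintegral_mul_le_carlesonSup hq (hF.mono_ac coneMeasure_absolutelyContinuous)
    (hG.mono_ac coneMeasure_absolutelyContinuous)).trans ?_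
  rw [ENNReal.coe_toNNReal hK]
  refine mul_le_mul_right (lintegral_mono fun x => mul_le_mul' ?_ ?_) _
  · exact carlesonSup_le_functionalC hq F x
  · exact gaussSup_le_gaussNorm G (measurableSet_cone x)
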